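/- Let $\Gamma_1$ and $\Gamma_2$ be finite simple graphs. For a finite simple graph $\Gamma$, let $G(\Gamma)$ be the right-angled Artin group with one generator for each vertex of $\Gamma$ and the relations $vw=wv$ for all adjacent vertices $v,w$. Let $F(\Gamma)$ be the flag complex of $\Gamma$, whose simplices are the nonempty cliques of $\Gamma$. For a vertex $v$, the closed star $St(v)$ is the full subcomplex of $F(\Gamma)$ spanned by $v$ and the vertices adjacent to $v$; it is called separating if $F(\Gamma)\setminus St(v)$ is disconnected, equivalently, if the full subgraph of $\Gamma$ spanned by the vertices outside $St(v)$ is disconnected (the empty graph is not considered disconnected). The extension graph $\Gamma^e$ is the graph whose vertices are the elements of $G(\Gamma)$ that are conjugate to one of the generators above, two distinct vertices being adjacent if and only if they commute in $G(\Gamma)$. The extension complex $\mathcal P(\Gamma)$ is the flag complex of $\Gamma^e$ (its simplices are the nonempty finite cliques of $\Gamma^e$). Suppose that for $i=1,2$: 1. no closed star of a vertex in $F(\Gamma_i)$ is separating; 2. $F(\Gamma_i)$ is not contained in a union $St(v)\cup St(w)$ of the closed stars of two (possibly equal) vertices $v,w$ of $\Gamma_i$. Then the groups $G(\Gamma_1)$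 and $G(\Gamma_2)$ are isomorphic if and only if $\mathcal P(\Gamma_1)$ and $\mathcal P(\Gamma_2)$ are isomorphic as simplicial complexes. -/

import Mathlib

namespace RAAG

/-- The right-angled Artin group `G(Γ)`: one generator for each vertex of `Γ`, and the relation
`[v, w] = 1` for each pair of adjacent vertices. -/
abbrev Grp {V : Type*} (Γ : SimpleGraph V) : Type _ :=
  PresentedGroup {r : FreeGroup V |
    ∃ v w : V, Γ.Adj v w ∧
      r = FreeGroup.of v * FreeGroup.of w * (FreeGroup.of v)⁻¹ * (FreeGroup.of w)⁻¹}

/-- The standard generator of `G(Γ)` given by a vertex of `Γ`. -/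
def gen {V : Type*} (Γ : SimpleGraph V) (v : V) : Grp Γ := PresentedGroup.of v

/-- The flag complex `F(Γ)` of a graph: its simplices are the nonempty finite cliques. -/
def flagComplex {V : Type*} (Γ : SimpleGraph V) : AbstractSimplicialComplex V where
  faces := {s | s.Nonempty ∧ Γ.IsClique (s : Set V)}
  isRelLowerSet_faces := fun _ hs =>
    ⟨hs.1, fun _ hts ht => ⟨ht, hs.2.subset (Finset.coe_subset.mpr hts)⟩⟩
  singleton_mem v := ⟨Finset.singleton_nonempty v, by simp⟩

/-- The full subcomplex of `K` spanned by a set `S` of vertices. -/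
def fullSubcomplex {V : Type*} (K : PreAbstractSimplicialComplex V) (S : Set V) :
    PreAbstractSimplicialComplex V where
  faces := {s | s ∈ K.faces ∧ (s : Set V) ⊆ S}
  isRelLowerSet_faces := fun _ hs =>
    ⟨(K.isRelLowerSet_faces hs.1).1, fun _ hts ht =>
      ⟨(K.isRelLowerSet_faces hs.1).2 hts ht, (Finset.coe_subset.mpr hts).trans hs.2⟩⟩

/-- The vertex set of the closed star of `v`: the vertex `v` and all vertices adjacent to it. -/
def starVerts {V : Type*} (Γ : SimpleGraph V) (v : V) : Set V := insert v (Γ.neighborSet v)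

/-- The closed star `St(v)` of `v` in `F(Γ)`: the full subcomplex of `F(Γ)` spanned by `v` and the
vertices adjacent to `v`. -/
def closedStar {V : Type*} (Γ : SimpleGraph V) (v : V) : PreAbstractSimplicialComplex V :=
  fullSubcomplex (flagComplex Γ).toPreAbstractSimplicialComplex (starVerts Γ v)

/-- The closed star of `v` is separating if its complement is disconnected. Since `St(v)` is a full
subcomplex, the components of `F(Γ) ∖ St(v)` are those of the full subgraph of `Γ` spanned by the
vertices outside `St(v)`. An empty complement is not disconnected. -/
def IsSeparatingStar {V : Type*} (Γ : SimpleGraph V) (v : V) : Prop :=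
  ¬ (Γ.induce (starVerts Γ v)ᶜ).Preconnected

/-- `F(Γ)` is contained in (equivalently, is equal to) the union of the two subcomplexes `St(v)`
and `St(w)` for some vertices `v`, `w`, possibly equal. -/
def IsUnionOfTwoStars {V : Type*} (Γ : SimpleGraph V) : Prop :=
  ∃ v w : V,
    (flagComplex Γ).toPreAbstractSimplicialComplex ≤ closedStar Γ v ⊔ closedStar Γ w

/-- The vertices of the extension graph: the elements of `G(Γ)` that are conjugate to a standard
generator. -/
abbrev ExtVert {V : Type*} (Γ : SimpleGraph V) : Type _ :=
  {x : Grp Γ // ∃ v : V, IsConj (gen Γ v) x}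

/-- The extension graph of `Γ`: two distinct vertices are adjacent if and only if they commute
in `G(Γ)`. -/
def extensionGraph {V : Type*} (Γ : SimpleGraph V) : SimpleGraph (ExtVert Γ) where
  Adj x y := x ≠ y ∧ Commute (x : Grp Γ) (y : Grp Γ)
  symm := ⟨fun _ _ h => ⟨h.1.symm, h.2.symm⟩⟩
  loopless := ⟨fun _ h => h.1 rfl⟩

/-- The extension complex `P(Γ)`: the flag complex of the extension graph. -/
def extensionComplex {V : Type*} (Γ : SimpleGraph V) : AbstractSimplicialComplex (ExtVert Γ) :=
  flagComplex (extensionGraph Γ)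

/-- Two abstract simplicial complexes are isomorphic: there is a bijection between their vertex
sets under which the simplices correspond. -/
def SimpliciallyIsomorphic {α β : Type*} (K : AbstractSimplicialComplex α)
    (L : AbstractSimplicialComplex β) : Prop :=
  ∃ e : α ≃ β, ∀ s : Finset α, s ∈ K.faces ↔ s.map e.toEmbedding ∈ L.faces

end RAAG

/-! Both conditions are equivalent to `Γ₁ ≅ Γ₂`. A graph isomorphism induces the other two kinds, so
the task is to recover the graph from the complex and from the group.

From the complex: the tool is `cocycle`, a finitely supported 1-cocycle on `G(Γ)`. The integer
`cocycle g (gen Γ v)` says on which side of `v` the conjugate `g w g⁻¹` lies. If `v` does not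
commute with that conjugate, the side depends only on the conjugate, and commuting conjugates share
it (`cocycle_apply_eq_of_commute`). The hypotheses on stars make the generators connected off every
centralizer of a conjugate (`connectedOff_gen`), a property phrased by commutation alone and hence
inherited by their images under an isomorphism of complexes. So the images off the centralizer of
`v` share one side, and conjugating all of them by a power of `v` shortens conjugators. By induction
the images are simultaneously conjugate to generators (`exists_conj_eq_gen`). This embeds each graph
in the other; finiteness does the rest.

From the group: an isomorphism gives an invertible matrix on abelianizations. Heisenberg quotients
force its 2×2 minors for commuting generators and nonadjacent columns to vanish. A nonzero Leibniz
term of the determinant gives a bijection `σ` of vertices; the minors give `|St v| ≤ |St (σ v)|`,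
summation gives equality, and then `σ` preserves adjacency since no link lies in the link of a
nonadjacent vertex. -/

namespace RAAG

variable {V : Type*} {Γ : SimpleGraph V}

/-! ### Homomorphisms out of the presentation. -/

/-- The homomorphism from `G(Γ)` given by a map on vertices under which adjacent vertices have
commuting images. -/
def lift {H : Type*} [Group H] (F : V → H) (hF : ∀ v w, Γ.Adj v w → Commute (F v) (F w)) :
    Grp Γ →* H :=
  PresentedGroup.toGroup (f := F) (by
    rintro r ⟨v, w, h, rfl⟩
    simp only [map_mul, map_inv, FreeGroup.lift_apply_of]
    rw [(hF v w h).eq]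
    group)

@[simp]
theorem lift_gen {H : Type*} [Group H] (F : V → H)
    (hF : ∀ v w, Γ.Adj v w → Commute (F v) (F w)) (v : V) : lift F hF (gen Γ v) = F v :=
  PresentedGroup.toGroup.of _

theorem hom_ext {H : Type*} [Group H] {φ ψ : Grp Γ →* H}
    (h : ∀ v, φ (gen Γ v) = ψ (gen Γ v)) : φ = ψ :=
  MonoidHom.eq_of_eqOn_dense (PresentedGroup.closure_range_of _) (by
    rintro _ ⟨v, rfl⟩
    exact h v)

theorem commute_gen {v w : V} (h : Γ.Adj v w) : Commute (gen Γ v) (gen Γ w) := by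
  have h1 : PresentedGroup.mk {r : FreeGroup V | ∃ v w : V, Γ.Adj v w ∧
      r = FreeGroup.of v * FreeGroup.of w * (FreeGroup.of v)⁻¹ * (FreeGroup.of w)⁻¹}
      (FreeGroup.of v * FreeGroup.of w * (FreeGroup.of v)⁻¹ * (FreeGroup.of w)⁻¹) = 1 :=
    PresentedGroup.one_of_mem ⟨v, w, h, rfl⟩
  simp only [map_mul, map_inv] at h1
  exact mul_inv_eq_iff_eq_mul.mp (mul_inv_eq_one.mp h1)

/-! ### The conjugation cocycle. -/

/-- Finitely supported integral functions on `G(Γ)`, acted upon by conjugation. -/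
abbrev ConjFun (Γ : SimpleGraph V) : Type _ := Grp Γ →₀ ℤ

/-- Translation of a finitely supported function by a conjugation. -/
noncomputable def conjAct (g : Grp Γ) : ConjFun Γ ≃+ ConjFun Γ :=
  Finsupp.domCongr (MulAut.conj g).toEquiv

@[simp]
theorem conjAct_apply (g : Grp Γ) (a : ConjFun Γ) (x : Grp Γ) :
    conjAct g a x = a (g⁻¹ * x * g) := by
  simp [conjAct, Finsupp.domCongr, Finsupp.equivMapDomain_apply]

theorem conjAct_single (g x : Grp Γ) (n : ℤ) :
    conjAct g (Finsupp.single x n) = Finsupp.single (g * x * g⁻¹) n := by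
  simp [conjAct, Finsupp.domCongr]

/-- Conjugation as an action by automorphisms of the multiplicative group of functions. -/
noncomputable def conjHom (Γ : SimpleGraph V) :
    Grp Γ →* MulAut (Multiplicative (ConjFun Γ)) where
  toFun g := (conjAct g).toMultiplicative
  map_one' := by
    ext a x
    change conjAct 1 (Multiplicative.toAdd a) x = Multiplicative.toAdd a x
    simp
  map_mul' g h := by
    ext a x
    change conjAct (g * h) (Multiplicative.toAdd a) x =
      conjAct g (conjAct h (Multiplicative.toAdd a)) x
    simp [mul_assoc]

/-- The homomorphism to the semidirect product whose first component is the cocycle. -/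
noncomputable def cocycleHom (Γ : SimpleGraph V) :
    Grp Γ →* Multiplicative (ConjFun Γ) ⋊[conjHom Γ] Grp Γ :=
  lift (F := fun v => ⟨Multiplicative.ofAdd (Finsupp.single (gen Γ v) 1), gen Γ v⟩) (by
    have key : ∀ v w, Γ.Adj v w → conjHom Γ (gen Γ v)
        (Multiplicative.ofAdd (Finsupp.single (gen Γ w) 1)) =
          Multiplicative.ofAdd (Finsupp.single (gen Γ w) 1) := by
      intro v w h
      change Multiplicative.ofAdd (conjAct (gen Γ v) (Finsupp.single (gen Γ w) 1)) = _
      rw [conjAct_single, (commute_gen h).eq, mul_inv_cancel_right]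
    intro v w h
    refine SemidirectProduct.ext ?_ (commute_gen h).eq
    simp only [SemidirectProduct.mul_left]
    rw [key v w h, key w v h.symm, mul_comm])

theorem cocycleHom_right (g : Grp Γ) : (cocycleHom Γ g).right = g := by
  have : SemidirectProduct.rightHom.comp (cocycleHom Γ) = MonoidHom.id (Grp Γ) :=
    hom_ext fun v => by simp [cocycleHom]
  exact DFunLike.congr_fun this g

/-- The cocycle on `G(Γ)` with values in the conjugation module which sends each standard generator
to its own indicator function. Its support at `g` is the set of parallelism classes of standard
lines crossed on the way from `1` to `g`. -/
noncomputable def cocycle (g : Grp Γ) : ConjFun Γ := Multiplicative.toAdd (cocycleHom Γ g).left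

theorem cocycle_gen (v : V) : cocycle (gen Γ v) = Finsupp.single (gen Γ v) 1 := by
  simp [cocycle, cocycleHom]

theorem cocycle_mul (g h : Grp Γ) : cocycle (g * h) = cocycle g + conjAct g (cocycle h) := by
  have : (cocycleHom Γ (g * h)).left =
      (cocycleHom Γ g).left * conjHom Γ g (cocycleHom Γ h).left := by
    rw [map_mul, SemidirectProduct.mul_left, cocycleHom_right]
  exact congrArg Multiplicative.toAdd this

theorem cocycle_mul_apply (g h x : Grp Γ) :
    cocycle (g * h) x = cocycle g x + cocycle h (g⁻¹ * x * g) := by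
  simp [cocycle_mul]

@[simp]
theorem cocycle_one : cocycle (1 : Grp Γ) = 0 := by
  simp [cocycle]

theorem cocycle_gen_zpow (v : V) (n : ℤ) :
    cocycle (gen Γ v ^ n) = Finsupp.single (gen Γ v) n := by
  have step : ∀ n : ℤ, cocycle (gen Γ v ^ (n + 1)) =
      cocycle (gen Γ v ^ n) + Finsupp.single (gen Γ v) 1 := by
    intro n
    rw [zpow_add_one, cocycle_mul, cocycle_gen, conjAct_single,
      (Commute.zpow_self (gen Γ v) n).eq, mul_inv_cancel_right]
  induction n using Int.induction_on with
  | zero => simp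
  | succ n ih => rw [step, ih, ← Finsupp.single_add]
  | pred n ih =>
    have := step (-(n : ℤ) - 1)
    rw [sub_add_cancel, ih] at this
    rw [Finsupp.single_sub, this, add_sub_cancel_right]

/-! ### Words in syllables and the support of the cocycle. -/

/-- The element of `G(Γ)` spelled by a list of syllables. -/
def spell (Γ : SimpleGraph V) (l : List (V × ℤ)) : Grp Γ := (l.map fun a => gen Γ a.1 ^ a.2).prod

@[simp] theorem spell_nil : spell Γ [] = 1 := rfl

@[simp] theorem spell_cons (a : V × ℤ) (l : List (V × ℤ)) :
    spell Γ (a :: l) = gen Γ a.1 ^ a.2 * spell Γ l := by simp [spell]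

@[simp] theorem spell_append (l m : List (V × ℤ)) :
    spell Γ (l ++ m) = spell Γ l * spell Γ m := by simp [spell]

theorem exists_spell (g : Grp Γ) : ∃ l, spell Γ l = g := by
  have hg : g ∈ Subgroup.closure (Set.range (gen Γ)) := by
    have : Subgroup.closure (Set.range (gen Γ)) = ⊤ := PresentedGroup.closure_range_of _
    rw [this]; trivial
  induction hg using Subgroup.closure_induction'' with
  | mem x hx => obtain ⟨v, rfl⟩ := hx; exact ⟨[(v, 1)], by simp⟩
  | inv_mem x hx => obtain ⟨v, rfl⟩ := hx; exact ⟨[(v, -1)], by simp⟩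
  | one => exact ⟨[], rfl⟩
  | mul x y _ _ hx hy =>
    obtain ⟨l, rfl⟩ := hx
    obtain ⟨m, rfl⟩ := hy
    exact ⟨l ++ m, by simp⟩

/-- By the cocycle rule, a syllable `w ^ m` after a prefix `p` contributes only at `p w p⁻¹`. -/
theorem exists_split_of_cocycle_ne_zero (l : List (V × ℤ)) (x : Grp Γ)
    (h : cocycle (spell Γ l) x ≠ 0) :
    ∃ p w m r, l = p ++ (w, m) :: r ∧ x = spell Γ p * gen Γ w * (spell Γ p)⁻¹ := by
  induction l generalizing x with
  | nil => simp at h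
  | cons a l ih =>
    by_cases hx : x = gen Γ a.1
    · exact ⟨[], a.1, a.2, l, rfl, by simp [hx]⟩
    · rw [spell_cons, cocycle_mul_apply, cocycle_gen_zpow, Finsupp.single_eq_of_ne hx,
        zero_add] at h
      obtain ⟨p, w, m, r, rfl, hp⟩ := ih _ h
      refine ⟨a :: p, w, m, r, rfl, ?_⟩
      rw [spell_cons]
      calc x = gen Γ a.1 ^ a.2 * ((gen Γ a.1 ^ a.2)⁻¹ * x * gen Γ a.1 ^ a.2) *
            (gen Γ a.1 ^ a.2)⁻¹ := by group
        _ = _ := by rw [hp]; group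

theorem gen_eq_of_conj {v w : V} {g : Grp Γ} (h : gen Γ v = g * gen Γ w * g⁻¹) : v = w := by
  classical
  let φ : Grp Γ →* Multiplicative (V →₀ ℤ) :=
    lift (F := fun v => Multiplicative.ofAdd (Finsupp.single v 1)) fun _ _ _ => Commute.all _ _
  have := congrArg φ h
  rw [map_mul, map_mul, map_inv, mul_comm (φ g), mul_inv_cancel_right] at this
  simp only [φ, lift_gen] at this
  exact Finsupp.single_left_injective one_ne_zero (Multiplicative.ofAdd.injective this)

theorem gen_injective : Function.Injective (gen Γ) := fun v w h =>
  gen_eq_of_conj (g := 1) (by simpa using h)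

/-- A nontrivial element has a left syllable which is visible in the cocycle. -/
theorem exists_cocycle_gen_ne_zero {g : Grp Γ} (hg : g ≠ 1) : ∃ v, cocycle g (gen Γ v) ≠ 0 := by
  classical
  -- In a shortest spelling the first syllable cannot be cancelled: the cancelling contribution
  -- would come from a later `v`-syllable whose prefix commutes with `v`, and the two could be
  -- merged.
  obtain ⟨l, rfl, hmin⟩ : ∃ l, spell Γ l = g ∧ ∀ m, spell Γ m = g → l.length ≤ m.length := by
    have hex : ∃ n, ∃ l, spell Γ l = g ∧ l.length = n := by
      obtain ⟨l, hl⟩ := exists_spell g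
      exact ⟨_, l, hl, rfl⟩
    obtain ⟨l, hl, hn⟩ := Nat.find_spec hex
    exact ⟨l, hl, fun m hm => hn ▸ Nat.find_min' hex ⟨m, hm, rfl⟩⟩
  match l, hg, hmin with
  | [], hg, _ => exact absurd rfl hg
  | (v, n) :: l, hg, hmin =>
    refine ⟨v, fun h0 => ?_⟩
    rw [spell_cons, cocycle_mul_apply, cocycle_gen_zpow, Finsupp.single_eq_same] at h0
    have hfix : (gen Γ v ^ n)⁻¹ * gen Γ v * gen Γ v ^ n = gen Γ v := by
      rw [mul_assoc, ((Commute.refl (gen Γ v)).zpow_right n).eq, inv_mul_cancel_left]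
    simp only [hfix] at h0
    by_cases hn : n = 0
    · have := hmin l (by simp [hn])
      simp at this
    · obtain ⟨p, w, m, r, rfl, hp⟩ := exists_split_of_cocycle_ne_zero l (gen Γ v) (by omega)
      obtain rfl := gen_eq_of_conj hp
      have hc : Commute (gen Γ v) (spell Γ p) := eq_mul_inv_iff_mul_eq.mp hp
      have := hmin (p ++ (v, n + m) :: r) (by
        simp only [spell_append, spell_cons, zpow_add]
        rw [← mul_assoc, ← mul_assoc, ← (hc.zpow_left n).eq]
        group)
      simp at this

/-- The number of parallelism classes of standard lines crossed by `g`. -/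
noncomputable def lineCount (g : Grp Γ) : ℕ := (cocycle g).support.card

/-- Stripping this power of `v` erases `v` from the support and conjugates the rest. -/
theorem lineCount_strip_lt {g : Grp Γ} {v : V} (h : cocycle g (gen Γ v) ≠ 0) :
    lineCount (gen Γ v ^ (-cocycle g (gen Γ v)) * g) < lineCount g := by
  classical
  set n := cocycle g (gen Γ v) with hn
  have key : ∀ x, cocycle (gen Γ v ^ (-n) * g) x =
      (cocycle g).erase (gen Γ v) (gen Γ v ^ n * x * (gen Γ v ^ n)⁻¹) := by
    intro x
    rw [cocycle_mul_apply, cocycle_gen_zpow]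
    have hc : gen Γ v ^ n * gen Γ v * (gen Γ v ^ n)⁻¹ = gen Γ v := by
      rw [(Commute.zpow_self (gen Γ v) n).eq, mul_inv_cancel_right]
    by_cases hx : x = gen Γ v
    · subst hx
      simp only [zpow_neg, inv_inv, hc, Finsupp.single_eq_same, Finsupp.erase_same, ← hn]
      ring
    · have hx' : gen Γ v ^ n * x * (gen Γ v ^ n)⁻¹ ≠ gen Γ v := by
        intro h'
        apply hx
        calc x = (gen Γ v ^ n)⁻¹ * (gen Γ v ^ n * x * (gen Γ v ^ n)⁻¹) * gen Γ v ^ n := by group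
          _ = gen Γ v := by
            rw [h', mul_assoc, ← (Commute.zpow_self (gen Γ v) n).eq, inv_mul_cancel_left]
      rw [Finsupp.single_eq_of_ne hx, Finsupp.erase_ne hx']
      simp
  refine lt_of_le_of_lt (b := ((cocycle g).erase (gen Γ v)).support.card) ?_ ?_
  · refine Finset.card_le_card_of_injOn
      (fun x => gen Γ v ^ n * x * (gen Γ v ^ n)⁻¹) (fun x hx => ?_) (fun x _ y _ hxy => ?_)
    · simp only [Finset.mem_coe, Finsupp.mem_support_iff, key] at hx ⊢
      exact hx
    · simpa using hxy
  · rw [Finsupp.support_erase]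
    exact Finset.card_erase_lt_of_mem (Finsupp.mem_support_iff.mpr h)

/-- An element which commutes with a nontrivial power of a generator commutes with the generator. -/
theorem commute_of_commute_zpow {r : Grp Γ} {w : V} {k : ℤ} (hk : k ≠ 0)
    (h : Commute r (gen Γ w ^ k)) : Commute r (gen Γ w) := by
  -- Evaluate the cocycle of `r w ^ k = w ^ k r` at `w`: if `r` did not commute with `w`, this would
  -- give `k = 0`.
  have h1 := cocycle_mul_apply r (gen Γ w ^ k) (gen Γ w)
  rw [h.eq, cocycle_mul_apply, cocycle_gen_zpow, Finsupp.single_eq_same] at h1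
  have hfix : (gen Γ w ^ k)⁻¹ * gen Γ w * gen Γ w ^ k = gen Γ w := by
    rw [mul_assoc, ((Commute.refl (gen Γ w)).zpow_right k).eq, inv_mul_cancel_left]
  rw [hfix] at h1
  by_contra hne
  have h2 : r⁻¹ * gen Γ w * r ≠ gen Γ w := by
    intro h2
    apply hne
    have : gen Γ w * r = r * gen Γ w := by
      calc gen Γ w * r = r * (r⁻¹ * gen Γ w * r) := by group
        _ = _ := by rw [h2]
    exact this.symm
  rw [Finsupp.single_eq_of_ne h2] at h1
  omega

/-- If the cocycle of `k` does not vanish on the orbit of `x` under conjugation by a generator, then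
the generator commutes with `x`. -/
theorem commute_of_cocycle_orbit {k x : Grp Γ} {w : V}
    (h : ∀ m : ℤ, cocycle k ((gen Γ w ^ m)⁻¹ * x * gen Γ w ^ m) ≠ 0) : Commute x (gen Γ w) := by
  classical
  have hmaps : ∀ m : ℤ, (gen Γ w ^ m)⁻¹ * x * gen Γ w ^ m ∈ (cocycle k).support := fun m =>
    Finsupp.mem_support_iff.mpr (h m)
  obtain ⟨m, n, hmn, he⟩ := Finite.exists_ne_map_eq_of_infinite
    (fun m : ℤ => (⟨_, hmaps m⟩ : (cocycle k).support))
  have he' : (gen Γ w ^ m)⁻¹ * x * gen Γ w ^ m = (gen Γ w ^ n)⁻¹ * x * gen Γ w ^ n :=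
    congrArg Subtype.val he
  refine commute_of_commute_zpow (k := m - n) (sub_ne_zero.mpr hmn) ?_
  change x * gen Γ w ^ (m - n) = gen Γ w ^ (m - n) * x
  have : x * gen Γ w ^ (m - n) =
      gen Γ w ^ m * ((gen Γ w ^ m)⁻¹ * x * gen Γ w ^ m) * (gen Γ w ^ n)⁻¹ := by
    rw [zpow_sub]; group
  rw [this, he', zpow_sub]
  group

/-- The side of `v` on which a conjugate of a generator lies does not depend on the conjugator. -/
theorem cocycle_apply_eq_of_conj_eq {g h : Grp Γ} {v w u : V}
    (he : g * gen Γ w * g⁻¹ = h * gen Γ u * h⁻¹)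
    (hv : ¬ Commute (gen Γ v) (g * gen Γ w * g⁻¹)) :
    cocycle g (gen Γ v) = cocycle h (gen Γ v) := by
  have hwu : gen Γ u = (h⁻¹ * g) * gen Γ w * (h⁻¹ * g)⁻¹ := by
    calc gen Γ u = h⁻¹ * (h * gen Γ u * h⁻¹) * h := by group
      _ = _ := by rw [← he]; group
  obtain rfl := gen_eq_of_conj hwu
  set s := g⁻¹ * h with hs
  have hh : h = g * s := by rw [hs]; group
  have hsc : Commute (gen Γ u) s := by
    change gen Γ u * s = s * gen Γ u
    calc gen Γ u * s = g⁻¹ * (g * gen Γ u * g⁻¹) * h := by rw [hs]; group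
      _ = _ := by rw [he, hs]; group
  rw [hh, cocycle_mul_apply]
  by_contra hne
  have h0 : cocycle s (g⁻¹ * gen Γ v * g) ≠ 0 := by
    intro h0; rw [h0] at hne; simp at hne
  apply hv
  have hx : g⁻¹ * gen Γ v * g ≠ gen Γ u := by
    intro hx
    apply hv
    have : gen Γ v = g * gen Γ u * g⁻¹ := by rw [← hx]; group
    rw [← this]
  -- Since `s` commutes with `u`, comparing `s u ^ m` with `u ^ m s` shows that `cocycle s` is
  -- constant on the `u`-orbit of this point; finite support then forces commutation.
  have hcom : Commute (g⁻¹ * gen Γ v * g) (gen Γ u) := by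
    refine commute_of_cocycle_orbit (k := s) fun m => ?_
    by_cases hxm : (gen Γ u ^ m)⁻¹ * (g⁻¹ * gen Γ v * g) * gen Γ u ^ m = gen Γ u
    · exfalso
      apply hx
      calc g⁻¹ * gen Γ v * g = gen Γ u ^ m *
            ((gen Γ u ^ m)⁻¹ * (g⁻¹ * gen Γ v * g) * gen Γ u ^ m) * (gen Γ u ^ m)⁻¹ := by group
        _ = gen Γ u := by
          rw [hxm, (Commute.zpow_self (gen Γ u) m).eq, mul_inv_cancel_right]
    · have e := cocycle_mul_apply (gen Γ u ^ m) s (g⁻¹ * gen Γ v * g)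
      rw [(hsc.zpow_left m).eq, cocycle_mul_apply, cocycle_gen_zpow,
        Finsupp.single_eq_of_ne hx, zero_add, Finsupp.single_eq_of_ne, add_zero] at e
      · rwa [← e]
      · intro h'
        apply hx
        calc g⁻¹ * gen Γ v * g = s * (s⁻¹ * (g⁻¹ * gen Γ v * g) * s) * s⁻¹ := by group
          _ = gen Γ u := by rw [h', ← hsc.eq, mul_inv_cancel_right]
  have := hcom.map (MulAut.conj g).toMonoidHom
  simpa [mul_assoc] using this

/-! ### Heisenberg quotients and exponent sums. -/

/-- The integral Heisenberg group. -/
@[ext]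
structure Heis where
  /-- The first coordinate. -/
  x : ℤ
  /-- The second coordinate. -/
  y : ℤ
  /-- The central coordinate. -/
  z : ℤ

namespace Heis

instance : Mul Heis := ⟨fun g h => ⟨g.x + h.x, g.y + h.y, g.z + h.z + g.x * h.y⟩⟩
instance : One Heis := ⟨⟨0, 0, 0⟩⟩
instance : Inv Heis := ⟨fun g => ⟨-g.x, -g.y, -g.z + g.x * g.y⟩⟩

@[simp] theorem mul_x (g h : Heis) : (g * h).x = g.x + h.x := rfl
@[simp] theorem mul_y (g h : Heis) : (g * h).y = g.y + h.y := rfl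
@[simp] theorem mul_z (g h : Heis) : (g * h).z = g.z + h.z + g.x * h.y := rfl
@[simp] theorem one_x : (1 : Heis).x = 0 := rfl
@[simp] theorem one_y : (1 : Heis).y = 0 := rfl
@[simp] theorem one_z : (1 : Heis).z = 0 := rfl
@[simp] theorem inv_x (g : Heis) : g⁻¹.x = -g.x := rfl
@[simp] theorem inv_y (g : Heis) : g⁻¹.y = -g.y := rfl
@[simp] theorem inv_z (g : Heis) : g⁻¹.z = -g.z + g.x * g.y := rfl

instance : Group Heis := Group.ofLeftAxioms
  (fun a b c => by ext <;> simp <;> ring) (fun a => by ext <;> simp)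
  (fun a => by ext <;> simp)

theorem commute_iff {g h : Heis} : Commute g h ↔ g.x * h.y = h.x * g.y := by
  refine ⟨fun e => ?_, fun e => ?_⟩
  · have := congrArg Heis.z e.eq
    simp only [mul_z] at this
    linarith
  · change g * h = h * g
    ext
    · exact add_comm _ _
    · exact add_comm _ _
    · simp only [mul_z]; linarith

/-- The first coordinate as a homomorphism. -/
def xHom : Heis →* Multiplicative ℤ where
  toFun g := Multiplicative.ofAdd g.x
  map_one' := rfl
  map_mul' _ _ := rfl

/-- The second coordinate as a homomorphism. -/
def yHom : Heis →* Multiplicative ℤ where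
  toFun g := Multiplicative.ofAdd g.y
  map_one' := rfl
  map_mul' _ _ := rfl

end Heis

open Classical in
/-- The exponent sum of a generator, as a homomorphism. -/
noncomputable def expHom (Γ : SimpleGraph V) (v : V) : Grp Γ →* Multiplicative ℤ :=
  lift (fun u => Multiplicative.ofAdd (if u = v then 1 else 0)) fun _ _ _ => Commute.all _ _

/-- The exponent sum of a generator. -/
noncomputable def expSum (g : Grp Γ) (v : V) : ℤ := Multiplicative.toAdd (expHom Γ v g)

open Classical in
theorem expSum_gen (u v : V) : expSum (gen Γ u) v = if u = v then 1 else 0 := by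
  simp [expSum, expHom]

theorem expSum_mul (g h : Grp Γ) (v : V) : expSum (g * h) v = expSum g v + expSum h v := by
  simp [expSum]

/-- As `v` and `w` are nonadjacent, sending them to the two standard Heisenberg generators and all
other vertices to `1` is a homomorphism; commuting in its image means a vanishing minor. -/
theorem expSum_mul_eq_of_commute {g h : Grp Γ} (hc : Commute g h) {v w : V} (hne : v ≠ w)
    (hadj : ¬ Γ.Adj v w) : expSum g v * expSum h w = expSum h v * expSum g w := by
  classical
  let F : V → Heis := fun u => ⟨if u = v then 1 else 0, if u = w then 1 else 0, 0⟩
  let φ : Grp Γ →* Heis := lift F (by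
    intro a b hab
    rw [Heis.commute_iff]
    by_cases h1 : a = v
    · have h2 : b ≠ w := by rintro rfl; exact hadj (h1 ▸ hab)
      have h3 : a ≠ w := fun h => hne (h1.symm.trans h)
      simp [F, h2, h3]
    · by_cases h2 : b = v
      · have h3 : a ≠ w := by rintro rfl; exact hadj (h2 ▸ hab.symm)
        simp [F, h1, h3]
      · simp [F, h1, h2])
  have hx : ∀ g, (φ g).x = expSum g v := fun g =>
    congrArg Multiplicative.toAdd (DFunLike.congr_fun
      (hom_ext (φ := Heis.xHom.comp φ) (ψ := expHom Γ v) fun u => by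
        simp [φ, F, expHom, Heis.xHom]) g)
  have hy : ∀ g, (φ g).y = expSum g w := fun g =>
    congrArg Multiplicative.toAdd (DFunLike.congr_fun
      (hom_ext (φ := Heis.yHom.comp φ) (ψ := expHom Γ w) fun u => by
        simp [φ, F, expHom, Heis.yHom]) g)
  simpa only [hx, hy] using Heis.commute_iff.mp (hc.map φ)

theorem commute_gen_iff {v w : V} : Commute (gen Γ v) (gen Γ w) ↔ v = w ∨ Γ.Adj v w := by
  classical
  refine ⟨fun h => ?_, ?_⟩
  · by_contra! hne
    have := expSum_mul_eq_of_commute h hne.1 hne.2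
    simp [expSum_gen, hne.1] at this
  · rintro (rfl | h)
    · exact Commute.refl _
    · exact commute_gen h

/-! ### Commuting conjugates and their sides. -/

theorem commute_gen_iff_mem_starVerts {v w : V} :
    Commute (gen Γ v) (gen Γ w) ↔ v ∈ starVerts Γ w := by
  rw [commute_gen_iff, starVerts, Set.mem_insert_iff, SimpleGraph.mem_neighborSet, Γ.adj_comm]

theorem conj_zpow_of_commute {a z : Grp Γ} (h : Commute a z) (n : ℤ) :
    a ^ n * z * (a ^ n)⁻¹ = z := by
  rw [(h.zpow_left n).eq, mul_inv_cancel_right]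

theorem commute_conj_iff {g a b : Grp Γ} :
    Commute (g * a * g⁻¹) (g * b * g⁻¹) ↔ Commute a b := by
  refine ⟨fun h => ?_, fun h => ?_⟩
  · simpa [mul_assoc] using h.map (MulAut.conj g⁻¹).toMonoidHom
  · simpa using h.map (MulAut.conj g).toMonoidHom

/-- A generator which commutes with a conjugate of a generator does so for the obvious reason. -/
theorem exists_commute_conj_eq {w : V} (k : Grp Γ) (u : V)
    (h : Commute (gen Γ w) (k * gen Γ u * k⁻¹)) :
    ∃ g, Commute (gen Γ w) g ∧ k * gen Γ u * k⁻¹ = g * gen Γ u * g⁻¹ := by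
  induction hN : lineCount k using Nat.strong_induction_on generalizing k with
  | _ N ih =>
    subst hN
    by_cases hk : k = 1
    · exact ⟨1, Commute.one_right _, by rw [hk]⟩
    obtain ⟨v, hv⟩ := exists_cocycle_gen_ne_zero hk
    set n := cocycle k (gen Γ v) with hn
    set k' := gen Γ v ^ (-n) * k with hk'
    have hlt := lineCount_strip_lt hv
    have hkk : k = gen Γ v ^ n * k' := by rw [hk']; group
    have hz : k * gen Γ u * k⁻¹ = gen Γ v ^ n * (k' * gen Γ u * k'⁻¹) * (gen Γ v ^ n)⁻¹ := by
      rw [hkk]; group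
    by_cases hc : Commute (gen Γ v) (k * gen Γ u * k⁻¹)
    · have hz' : k * gen Γ u * k⁻¹ = k' * gen Γ u * k'⁻¹ := by
        rw [← conj_zpow_of_commute hc (-n), hk']; group
      obtain ⟨g, hg, he⟩ := ih _ hlt k' (hz' ▸ h) rfl
      exact ⟨g, hg, hz'.trans he⟩
    · have hvw : v ≠ w := by rintro rfl; exact hc h
      -- Replacing `k` by `w ^ m k` does not change the conjugate, hence not its side of `v`; so
      -- `cocycle k` does not vanish on the `w`-orbit of `v`.
      have hcom : Commute (gen Γ v) (gen Γ w) := by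
        refine commute_of_cocycle_orbit (k := k) fun m => ?_
        have e : k * gen Γ u * k⁻¹ = (gen Γ w ^ m * k) * gen Γ u * (gen Γ w ^ m * k)⁻¹ := by
          rw [← conj_zpow_of_commute h m]; group
        have := cocycle_apply_eq_of_conj_eq e hc
        rw [cocycle_mul_apply, cocycle_gen_zpow,
          Finsupp.single_eq_of_ne (fun e => hvw (gen_injective e)), zero_add] at this
        rwa [← this]
      have hw' : gen Γ v ^ n * gen Γ w * (gen Γ v ^ n)⁻¹ = gen Γ w := conj_zpow_of_commute hcom n
      obtain ⟨g, hg, he⟩ := ih _ hlt k' (by rwa [hz, ← hw', commute_conj_iff] at h) rfl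
      refine ⟨gen Γ v ^ n * g, ?_, ?_⟩
      · exact (hcom.symm.zpow_right n).mul_right hg
      · rw [hz, he]; group

/-- Commuting conjugates of generators lie on the same side of a generator with which neither of
them commutes. -/
theorem cocycle_apply_eq_of_commute {g h : Grp Γ} {v w u : V}
    (hc : Commute (g * gen Γ w * g⁻¹) (h * gen Γ u * h⁻¹))
    (hg : ¬ Commute (gen Γ v) (g * gen Γ w * g⁻¹))
    (hh : ¬ Commute (gen Γ v) (h * gen Γ u * h⁻¹)) :
    cocycle g (gen Γ v) = cocycle h (gen Γ v) := by
  have hz : h * gen Γ u * h⁻¹ = g * ((g⁻¹ * h) * gen Γ u * (g⁻¹ * h)⁻¹) * g⁻¹ := by group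
  rw [hz, commute_conj_iff] at hc
  obtain ⟨k, hk, he⟩ := exists_commute_conj_eq _ _ hc
  have e1 : g * gen Γ w * g⁻¹ = (g * k) * gen Γ w * (g * k)⁻¹ := by
    rw [mul_assoc g k, ← hk.eq]; group
  have e2 : h * gen Γ u * h⁻¹ = (g * k) * gen Γ u * (g * k)⁻¹ := by
    rw [hz, he]; group
  rw [cocycle_apply_eq_of_conj_eq e1 hg, cocycle_apply_eq_of_conj_eq e2 hh]

/-- The generators commuting with a conjugate of a generator are those commuting with all
members of a suitable set of generators. -/
theorem exists_commute_iff_forall (k : Grp Γ) (w : V) :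
    ∃ T : Set V, ∀ u, Commute (gen Γ u) (k * gen Γ w * k⁻¹) ↔
      ∀ t ∈ T, Commute (gen Γ u) (gen Γ t) := by
  induction hN : lineCount k using Nat.strong_induction_on generalizing k with
  | _ N ih =>
    subst hN
    by_cases hk : k = 1
    · exact ⟨{w}, fun u => by simp [hk]⟩
    obtain ⟨v, hv⟩ := exists_cocycle_gen_ne_zero hk
    set n := cocycle k (gen Γ v) with hn
    set k' := gen Γ v ^ (-n) * k with hk'
    obtain ⟨T, hT⟩ := ih _ (lineCount_strip_lt hv) k' rfl
    have hz : k * gen Γ w * k⁻¹ = gen Γ v ^ n * (k' * gen Γ w * k'⁻¹) * (gen Γ v ^ n)⁻¹ := by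
      rw [hk']; group
    by_cases hc : Commute (gen Γ v) (k * gen Γ w * k⁻¹)
    · have hz' : k * gen Γ w * k⁻¹ = k' * gen Γ w * k'⁻¹ := by
        rw [← conj_zpow_of_commute hc (-n), hk']; group
      exact ⟨T, hz' ▸ hT⟩
    -- Otherwise `u`, on side `0` of `v`, would share a side with the conjugate, which is on side `n
    -- ≠ 0`.
    · have huv : ∀ u, Commute (gen Γ u) (k * gen Γ w * k⁻¹) → Commute (gen Γ u) (gen Γ v) := by
        intro u hu
        by_contra huv
        have := cocycle_apply_eq_of_commute (g := 1) (h := k) (v := v) (w := u) (u := w)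
          (by simpa using hu) (by simpa using fun h => huv h.symm) hc
        rw [cocycle_one] at this
        exact hv this.symm
      have hiff : ∀ u, Commute (gen Γ u) (gen Γ v) →
          (Commute (gen Γ u) (k * gen Γ w * k⁻¹) ↔ Commute (gen Γ u) (k' * gen Γ w * k'⁻¹)) := by
        intro u hu
        rw [hz]
        nth_rewrite 1 [← conj_zpow_of_commute hu.symm n]
        exact commute_conj_iff
      refine ⟨insert v T, fun u => ?_⟩
      rw [Set.forall_mem_insert, ← hT]
      exact ⟨fun h => ⟨huv u h, (hiff u (huv u h)).mp h⟩, fun h => (hiff u h.1).mpr h.2⟩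

/-! ### Connectedness off centralizers and simultaneous conjugation. -/

/-- A family of elements of a group is connected outside the centralizer of `x` if any set of
indices closed under commutation outside that centralizer contains no such index or all of them. -/
def ConnectedOff {ι G : Type*} [Group G] (y : ι → G) (x : G) : Prop :=
  ∀ S : ι → Prop,
    (∀ i j, ¬ Commute x (y i) → ¬ Commute x (y j) → Commute (y i) (y j) → S i → S j) →
    ∀ i j, ¬ Commute x (y i) → ¬ Commute x (y j) → S i → S j

/-- A finite family of conjugates of generators which is not disconnected by any star is
simultaneously conjugate into the generators. -/
theorem exists_conj_eq_gen {ι : Type*} [Finite ι] (g : ι → Grp Γ) (w : ι → V)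
    (hconn : ∀ (k : Grp Γ) (v : V),
      ConnectedOff (fun i => g i * gen Γ (w i) * (g i)⁻¹) (k * gen Γ v * k⁻¹)) :
    ∃ h : Grp Γ, ∀ i, g i * gen Γ (w i) * (g i)⁻¹ = h * gen Γ (w i) * h⁻¹ := by
  classical
  cases nonempty_fintype ι
  induction hN : ∑ i, lineCount (g i) using Nat.strong_induction_on generalizing g with
  | _ N ih =>
    subst hN
    by_cases h1 : ∀ i, g i = 1
    · exact ⟨1, fun i => by rw [h1 i]⟩
    push Not at h1
    obtain ⟨i₀, hi₀⟩ := h1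
    obtain ⟨v, hv⟩ := exists_cocycle_gen_ne_zero hi₀
    set n := cocycle (g i₀) (gen Γ v) with hn
    have hlt := lineCount_strip_lt hv
    -- If `v` commutes with this member, stripping `v` from its conjugator changes no member.
    -- Otherwise the whole family is conjugated by `v ^ (-n)`, which strips `v` from every member
    -- off the centralizer and fixes the others.
    by_cases hc : Commute (gen Γ v) (g i₀ * gen Γ (w i₀) * (g i₀)⁻¹)
    · let g' := Function.update g i₀ (gen Γ v ^ (-n) * g i₀)
      have hg' : ∀ i, g i * gen Γ (w i) * (g i)⁻¹ = g' i * gen Γ (w i) * (g' i)⁻¹ := by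
        intro i
        by_cases hi : i = i₀
        · subst hi
          simp only [g', Function.update_self]
          rw [← conj_zpow_of_commute hc (-n)]; group
        · simp [g', Function.update_of_ne hi]
      obtain ⟨h, hh⟩ := ih _ (Finset.sum_lt_sum (f := fun i => lineCount (g' i)) (fun i _ => by
        by_cases hi : i = i₀
        · subst hi; simpa [g'] using hlt.le
        · simp [g', Function.update_of_ne hi]) ⟨i₀, Finset.mem_univ _, by simpa [g'] using hlt⟩)
        g' (by simpa only [hg'] using hconn) rfl
      exact ⟨h, fun i => (hg' i).trans (hh i)⟩
    · have hside : ∀ i, ¬ Commute (gen Γ v) (g i * gen Γ (w i) * (g i)⁻¹) →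
          cocycle (g i) (gen Γ v) = n := by
        intro i hi
        have hcv := hconn 1 v
        rw [one_mul, inv_one, mul_one] at hcv
        refine hcv (fun i => cocycle (g i) (gen Γ v) = n) (fun i j hi hj hij e => ?_)
          i₀ i hc hi rfl
        rw [← e]
        exact (cocycle_apply_eq_of_commute hij hi hj).symm
      let g' : ι → Grp Γ := fun i => if Commute (gen Γ v) (g i * gen Γ (w i) * (g i)⁻¹) then g i
        else gen Γ v ^ (-n) * g i
      have hg' : ∀ i, g' i * gen Γ (w i) * (g' i)⁻¹ =
          gen Γ v ^ (-n) * (g i * gen Γ (w i) * (g i)⁻¹) * (gen Γ v ^ (-n))⁻¹ := by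
        intro i
        by_cases hi : Commute (gen Γ v) (g i * gen Γ (w i) * (g i)⁻¹)
        · simp only [g', if_pos hi, conj_zpow_of_commute hi]
        · simp only [g', if_neg hi]; group
      have hstrict : ∀ i, ¬ Commute (gen Γ v) (g i * gen Γ (w i) * (g i)⁻¹) →
          lineCount (g' i) < lineCount (g i) := by
        intro i hi
        simp only [g', if_neg hi]
        have e := hside i hi
        rw [← e]
        exact lineCount_strip_lt (by rwa [e])
      obtain ⟨h, hh⟩ := ih _ (Finset.sum_lt_sum (f := fun i => lineCount (g' i)) (fun i _ => by
        by_cases hi : Commute (gen Γ v) (g i * gen Γ (w i) * (g i)⁻¹)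
        · simp only [g', if_pos hi]; exact le_rfl
        · exact (hstrict i hi).le) ⟨i₀, Finset.mem_univ _, hstrict i₀ hc⟩) g' (by
          intro k u
          simp only [hg']
          have hx : k * gen Γ u * k⁻¹ = gen Γ v ^ (-n) *
              ((gen Γ v ^ n * k) * gen Γ u * (gen Γ v ^ n * k)⁻¹) * (gen Γ v ^ (-n))⁻¹ := by group
          rw [hx]
          have := hconn (gen Γ v ^ n * k) u
          simpa only [ConnectedOff, commute_conj_iff] using this) rfl
      refine ⟨gen Γ v ^ n * h, fun i => ?_⟩
      calc g i * gen Γ (w i) * (g i)⁻¹ = gen Γ v ^ n * (gen Γ v ^ (-n) *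
            (g i * gen Γ (w i) * (g i)⁻¹) * (gen Γ v ^ (-n))⁻¹) * (gen Γ v ^ n)⁻¹ := by group
        _ = _ := by rw [← hg', hh]; group

/-- If the complements of stars are connected and no two stars cover, then the generators are
connected off every conjugate of a generator. -/
theorem connectedOff_gen (hsep : ∀ v : V, ¬ IsSeparatingStar Γ v) (htwo : ¬ IsUnionOfTwoStars Γ)
    (k : Grp Γ) (w : V) : ConnectedOff (gen Γ) (k * gen Γ w * k⁻¹) := by
  obtain ⟨T, hT⟩ := exists_commute_iff_forall k w
  intro S hS
  have hoff : ∀ {u t}, t ∈ T → u ∉ starVerts Γ t →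
      ¬ Commute (k * gen Γ w * k⁻¹) (gen Γ u) := by
    intro u t ht hu hc
    exact hu (commute_gen_iff_mem_starVerts.mp ((hT u).mp hc.symm t ht))
  have hex : ∀ u, ¬ Commute (k * gen Γ w * k⁻¹) (gen Γ u) → ∃ t ∈ T, u ∉ starVerts Γ t := by
    intro u hu
    by_contra! hall
    exact hu ((hT u).mpr fun t ht => commute_gen_iff_mem_starVerts.mpr (hall t ht)).symm
  have hone : ∀ t ∈ T, ∀ u u', u ∉ starVerts Γ t → u' ∉ starVerts Γ t → S u → S u' := by
    intro t ht u u' hu hu' hSu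
    have hpre := not_not.mp (hsep t)
    obtain ⟨p⟩ := hpre ⟨u, hu⟩ ⟨u', hu'⟩
    have hwalk : ∀ (a b : ((starVerts Γ t)ᶜ : Set V))
        (_ : (Γ.induce (starVerts Γ t)ᶜ).Walk a b), S a → S b := by
      intro a b q
      induction q with
      | nil => exact id
      | @cons a b c hab _ ih =>
        exact fun ha => ih (hS _ _ (hoff ht a.2) (hoff ht b.2) (commute_gen hab) ha)
    exact hwalk _ _ p hSu
  intro i j hi hj hSi
  obtain ⟨t, ht, hit⟩ := hex i hi
  obtain ⟨s, hs, hjs⟩ := hex j hj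
  -- The region off the centralizer is a union of connected star complements. Any two of them meet
  -- or are joined by an edge, as otherwise the stars of `t` and `s` would cover.
  obtain ⟨p, q, hp, hq, hpq⟩ : ∃ p q, p ∉ starVerts Γ t ∧ q ∉ starVerts Γ s ∧
      (p = q ∨ Γ.Adj p q) := by
    by_contra! hno
    refine htwo ⟨t, s, fun F hF => ?_⟩
    by_cases hFt : (F : Set V) ⊆ starVerts Γ t
    · exact Or.inl ⟨hF, hFt⟩
    · refine Or.inr ⟨hF, fun q hq => ?_⟩
      obtain ⟨p, hpF, hp⟩ := Set.not_subset.mp hFt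
      by_contra hqs
      exact (hno p q hp hqs).2 (hF.2 hpF hq (hno p q hp hqs).1)
  have hSp := hone t ht i p hit hp hSi
  have hSq : S q := by
    rcases hpq with rfl | hpq
    · exact hSp
    · exact hS p q (hoff ht hp) (hoff hs hq) (commute_gen hpq) hSp
  exact hone s hs q j hq hjs hSq

end RAAG

namespace RAAG

/-! ### Recovering the graph from the extension complex. -/

section ExtensionGraph

variable {V V' : Type*} {Γ : SimpleGraph V} {Γ' : SimpleGraph V'}

/-- A generator as a vertex of the extension graph. -/
def extGen (Γ : SimpleGraph V) (v : V) : ExtVert Γ := ⟨gen Γ v, v, IsConj.refl _⟩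

theorem SimpliciallyIsomorphic.exists_commute_iff
    (h : SimpliciallyIsomorphic (extensionComplex Γ) (extensionComplex Γ')) :
    ∃ e : ExtVert Γ ≃ ExtVert Γ', ∀ x y, Commute (e x).1 (e y).1 ↔ Commute x.1 y.1 := by
  classical
  obtain ⟨e, he⟩ := h
  refine ⟨e, fun x y => ?_⟩
  by_cases hxy : x = y
  · simp [hxy]
  have h1 := he {x, y}
  have hne : e x ≠ e y := fun h => hxy (e.injective h)
  simp only [extensionComplex, flagComplex, Set.mem_ofPred_eq, Finset.map_insert,
    Finset.map_singleton, Finset.insert_nonempty, true_and, Finset.coe_insert,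
    Finset.coe_singleton, SimpleGraph.isClique_pair, Equiv.coe_toEmbedding] at h1
  have h2 := h1.symm
  simpa [extensionGraph, hxy] using h2

theorem exists_injective_of_extVert_equiv [Finite V]
    (hsep : ∀ v : V, ¬ IsSeparatingStar Γ v) (htwo : ¬ IsUnionOfTwoStars Γ)
    (e : ExtVert Γ ≃ ExtVert Γ') (he : ∀ x y, Commute (e x).1 (e y).1 ↔ Commute x.1 y.1) :
    ∃ σ : V → V', Function.Injective σ ∧ ∀ v w, Γ'.Adj (σ v) (σ w) ↔ Γ.Adj v w := by
  have hconj : ∀ v, ∃ (g : Grp Γ') (w : V'), g * gen Γ' w * g⁻¹ = (e (extGen Γ v)).1 := fun v => by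
    obtain ⟨w, hw⟩ := (e (extGen Γ v)).2
    obtain ⟨g, hg⟩ := isConj_iff.mp hw
    exact ⟨g, w, hg⟩
  choose g σ hg using hconj
  obtain ⟨h, hh⟩ := exists_conj_eq_gen g σ (by
    intro k v
    obtain ⟨x, hx⟩ : ∃ x, e x = ⟨k * gen Γ' v * k⁻¹, v, isConj_iff.mpr ⟨k, rfl⟩⟩ := e.surjective _
    have hx' : k * gen Γ' v * k⁻¹ = (e x).1 := congrArg Subtype.val hx.symm
    obtain ⟨w, hw⟩ := x.2
    obtain ⟨c, hc⟩ := isConj_iff.mp hw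
    have hconn := connectedOff_gen hsep htwo c w
    rw [hc] at hconn
    have hcx : ∀ i, Commute (e x).1 (e (extGen Γ i)).1 ↔ Commute x.1 (gen Γ i) := fun i => he _ _
    have hcc : ∀ i j, Commute (e (extGen Γ i)).1 (e (extGen Γ j)).1 ↔
        Commute (gen Γ i) (gen Γ j) := fun i j => he _ _
    rw [hx']
    simpa only [ConnectedOff, hg, hcx, hcc] using hconn)
  have hinj : Function.Injective σ := by
    intro v w hvw
    have : (e (extGen Γ v)).1 = (e (extGen Γ w)).1 := by
      rw [← hg, ← hg, hh, hh, hvw]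
    exact gen_injective (congrArg Subtype.val (e.injective (Subtype.ext this)))
  refine ⟨σ, hinj, fun v w => ?_⟩
  have h1 := he (extGen Γ v) (extGen Γ w)
  rw [← hg, ← hg, hh, hh, commute_conj_iff] at h1
  change _ ↔ Commute (gen Γ v) (gen Γ w) at h1
  rw [commute_gen_iff, commute_gen_iff, hinj.eq_iff] at h1
  by_cases hvw : v = w
  · subst hvw; simp
  · simpa [hvw] using h1

theorem nonempty_iso_of_extVert_equiv [Finite V] [Finite V']
    (hsep : ∀ v : V, ¬ IsSeparatingStar Γ v) (htwo : ¬ IsUnionOfTwoStars Γ)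
    (hsep' : ∀ v : V', ¬ IsSeparatingStar Γ' v) (htwo' : ¬ IsUnionOfTwoStars Γ')
    (e : ExtVert Γ ≃ ExtVert Γ') (he : ∀ x y, Commute (e x).1 (e y).1 ↔ Commute x.1 y.1) :
    Nonempty (Γ ≃g Γ') := by
  obtain ⟨σ, hσ, hadj⟩ := exists_injective_of_extVert_equiv hsep htwo e he
  obtain ⟨τ, hτ, -⟩ := exists_injective_of_extVert_equiv hsep' htwo' e.symm fun x y => by
    rw [← he, e.apply_symm_apply, e.apply_symm_apply]
  have hcard : Nat.card V = Nat.card V' :=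
    le_antisymm (Nat.card_le_card_of_injective σ hσ) (Nat.card_le_card_of_injective τ hτ)
  have hbij : Function.Bijective σ := (Nat.bijective_iff_injective_and_card σ).mpr ⟨hσ, hcard⟩
  exact ⟨⟨Equiv.ofBijective σ hbij, fun {v w} => hadj v w⟩⟩

/-- An isomorphism of graphs induces an isomorphism of right-angled Artin groups. -/
def grpCongr (f : Γ ≃g Γ') : Grp Γ ≃* Grp Γ' :=
  MonoidHom.toMulEquiv
    (lift (fun v => gen Γ' (f v)) fun _ _ h => commute_gen (f.map_rel_iff.mpr h))
    (lift (fun v => gen Γ (f.symm v)) fun _ _ h => commute_gen (f.symm.map_rel_iff.mpr h))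
    (hom_ext fun v => by simp) (hom_ext fun v => by simp)

theorem simpliciallyIsomorphic_of_iso (f : Γ ≃g Γ') :
    SimpliciallyIsomorphic (extensionComplex Γ) (extensionComplex Γ') := by
  have hgen : ∀ v, grpCongr f (gen Γ v) = gen Γ' (f v) := fun v => by
    simp [grpCongr]
  have hmem : ∀ x, (∃ v, IsConj (gen Γ v) x) ↔ ∃ v, IsConj (gen Γ' v) (grpCongr f x) := by
    intro x
    constructor
    · rintro ⟨v, hv⟩
      exact ⟨f v, hgen v ▸ (grpCongr f).toMonoidHom.map_isConj hv⟩
    · rintro ⟨v, hv⟩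
      refine ⟨f.symm v, ?_⟩
      have := (grpCongr f).symm.toMonoidHom.map_isConj hv
      have h2 : (grpCongr f).symm (gen Γ' v) = gen Γ (f.symm v) := by
        rw [MulEquiv.symm_apply_eq, hgen, f.apply_symm_apply]
      simpa [h2] using this
  refine ⟨(grpCongr f).toEquiv.subtypeEquiv hmem, fun s => ?_⟩
  simp only [extensionComplex, flagComplex, Set.mem_ofPred_eq, Finset.map_nonempty,
    Finset.coe_map, SimpleGraph.isClique_iff]
  refine and_congr_right fun _ => ?_
  rw [Equiv.coe_toEmbedding, Set.InjOn.pairwise_image (Equiv.injective _).injOn]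
  refine forall₅_congr fun x _ y _ hxy => ?_
  have hcomm : Commute (grpCongr f x.1) (grpCongr f y.1) ↔ Commute x.1 y.1 :=
    ⟨fun h => by simpa using h.map (grpCongr f).symm.toMonoidHom,
      fun h => h.map (grpCongr f).toMonoidHom⟩
  simp only [Function.onFun, extensionGraph]
  exact and_congr (not_congr (Equiv.injective _).eq_iff.symm) hcomm.symm

end ExtensionGraph

/-! ### Recovering the graph from the group. -/

section Rigidity

variable {V V' : Type*} {Γ : SimpleGraph V} {Γ' : SimpleGraph V'}

theorem expSum_map [Fintype V] (φ : Grp Γ →* Grp Γ') (g : Grp Γ) (u : V') :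
    expSum (φ g) u = ∑ w, expSum g w * expSum (φ (gen Γ w)) u := by
  classical
  let ψ : Grp Γ →* Multiplicative ℤ :=
    { toFun := fun g => Multiplicative.ofAdd (∑ w, expSum g w * expSum (φ (gen Γ w)) u)
      map_one' := by simp [expSum]
      map_mul' := fun g h => by
        rw [← ofAdd_add, ← Finset.sum_add_distrib]
        simp only [expSum_mul, add_mul] }
  have : (expHom Γ' u).comp φ = ψ := hom_ext fun v => by
    change expHom Γ' u (φ (gen Γ v)) =
      Multiplicative.ofAdd (∑ w, expSum (gen Γ v) w * expSum (φ (gen Γ w)) u)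
    simp only [expSum_gen, ite_mul, one_mul, zero_mul, Finset.sum_ite_eq, Finset.mem_univ, if_true]
    rfl
  exact congrArg Multiplicative.toAdd (DFunLike.congr_fun this g)

/-- The rational matrix of a homomorphism on abelianizations. -/
noncomputable def expMatrix (φ : Grp Γ →* Grp Γ') : Matrix V V' ℚ :=
  fun v w => expSum (φ (gen Γ v)) w

theorem expMatrix_mul_symm [Fintype V'] [DecidableEq V] (φ : Grp Γ ≃* Grp Γ') :
    expMatrix φ.toMonoidHom * expMatrix φ.symm.toMonoidHom = 1 := by
  classical
  ext v u
  have := expSum_map φ.symm.toMonoidHom (φ (gen Γ v)) u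
  simp only [MulEquiv.toMonoidHom_eq_coe, MonoidHom.coe_coe, φ.symm_apply_apply, expSum_gen] at this
  rw [Matrix.mul_apply, Matrix.one_apply]
  simp only [expMatrix, MulEquiv.toMonoidHom_eq_coe, MonoidHom.coe_coe]
  exact_mod_cast this.symm

/-- An invertible matrix is square with nonzero determinant, so some Leibniz term is nonzero. -/
theorem exists_equiv_of_mul_eq_one [Fintype V] [Fintype V'] [DecidableEq V] [DecidableEq V']
    {M : Matrix V V' ℚ} {N : Matrix V' V ℚ} (h : M * N = 1) (h' : N * M = 1) :
    ∃ σ : V ≃ V', ∀ v, M v (σ v) ≠ 0 := by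
  obtain ⟨e⟩ : Nonempty (V ≃ V') := by
    let L : (V' → ℚ) ≃ₗ[ℚ] (V → ℚ) := Matrix.toLin'OfInv h' h
    have := L.finrank_eq
    simp only [Module.finrank_fintype_fun_eq_card] at this
    exact Fintype.card_eq.mp this.symm
  have hdet : (M.submatrix id e).det ≠ 0 := by
    intro h0
    have h1 : M.submatrix id e * N.submatrix e id = 1 := by
      rw [Matrix.submatrix_mul_equiv, h, Matrix.submatrix_one _ Function.injective_id]
    have := congrArg Matrix.det h1
    rw [Matrix.det_mul, h0, zero_mul, Matrix.det_one] at this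
    exact zero_ne_one this
  rw [Matrix.det_apply] at hdet
  obtain ⟨τ, -, hτ⟩ := Finset.exists_ne_zero_of_sum_ne_zero hdet
  have hprod : ∏ i, M (τ i) (e i) ≠ 0 := fun h0 => hτ (by
    simp only [Matrix.submatrix_apply, id_eq, h0, smul_zero])
  refine ⟨τ.symm.trans e, fun v => ?_⟩
  have := Finset.prod_ne_zero_iff.mp hprod (τ.symm v) (Finset.mem_univ _)
  simpa using this

theorem linearIndependent_expMatrix [Finite V] [Finite V'] (φ : Grp Γ ≃* Grp Γ') :
    LinearIndependent ℚ (fun v => (expMatrix φ.toMonoidHom v : V' → ℚ)) := by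
  classical
  cases nonempty_fintype V
  cases nonempty_fintype V'
  rw [Fintype.linearIndependent_iff]
  intro c hc
  have h1 : Matrix.vecMul c (expMatrix φ.toMonoidHom) = 0 := by
    ext w
    have := congrFun hc w
    simpa [Matrix.vecMul, dotProduct] using this
  have h2 := congrArg (fun x => Matrix.vecMul x (expMatrix φ.symm.toMonoidHom)) h1
  simp only [Matrix.vecMul_vecMul, expMatrix_mul_symm, Matrix.vecMul_one, Matrix.zero_vecMul] at h2
  exact congrFun h2

section Star

variable (φ : Grp Γ ≃* Grp Γ') (v : V)

/-- The span of the exponent vectors of the images of the generators in the star of a vertex. -/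
def starSpan : Submodule ℚ (V' → ℚ) :=
  Submodule.span ℚ (Set.range fun u : starVerts Γ v => (expMatrix φ.toMonoidHom u.1 : V' → ℚ))

variable {φ v}

/-- The identity is linear in `y`, and on the spanning vectors it is the Heisenberg minor. -/
theorem mul_eq_of_mem_starSpan {y : V' → ℚ} (hy : y ∈ starSpan φ v) {a b : V'} (hne : a ≠ b)
    (hadj : ¬ Γ'.Adj a b) :
    expMatrix φ.toMonoidHom v a * y b = y a * expMatrix φ.toMonoidHom v b := by
  induction hy using Submodule.span_induction with
  | mem x hx =>
    obtain ⟨u, rfl⟩ := hx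
    have hc := (commute_gen_iff_mem_starVerts.mpr u.2).symm.map φ.toMonoidHom
    have := expSum_mul_eq_of_commute hc hne hadj
    simp only [expMatrix]
    exact_mod_cast this
  | zero => simp
  | add x y _ _ hx hy => simp only [Pi.add_apply, mul_add, add_mul, hx, hy]
  | smul c x _ hx =>
    simp only [Pi.smul_apply, smul_eq_mul]
    linear_combination c * hx

variable {s : V'}

/-- For `b` outside the star of `s`, the minor at `s, b` determines `y b` from `y s`, so restriction
to the star is injective on the span. -/
theorem disjoint_starSpan_ker (hs : expMatrix φ.toMonoidHom v s ≠ 0) :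
    Disjoint (starSpan φ v) (LinearMap.ker (LinearMap.funLeft ℚ ℚ
      (Subtype.val : starVerts Γ' s → V'))) := by
  rw [Submodule.disjoint_def]
  intro y hy hker
  have h0 : ∀ a ∈ starVerts Γ' s, y a = 0 := fun a ha =>
    congrFun (LinearMap.mem_ker.mp hker) ⟨a, ha⟩
  ext b
  by_cases hb : b ∈ starVerts Γ' s
  · exact h0 b hb
  · rw [starVerts, Set.mem_insert_iff, SimpleGraph.mem_neighborSet, not_or] at hb
    have := mul_eq_of_mem_starSpan hy (Ne.symm hb.1) hb.2
    rw [h0 s (Set.mem_insert _ _), zero_mul] at this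
    exact (mul_eq_zero.mp this).resolve_left hs

variable [Finite V] [Finite V']

theorem linearIndependent_star (hs : expMatrix φ.toMonoidHom v s ≠ 0) :
    LinearIndependent ℚ (LinearMap.funLeft ℚ ℚ (Subtype.val : starVerts Γ' s → V') ∘
      fun u : starVerts Γ v => (expMatrix φ.toMonoidHom u.1 : V' → ℚ)) :=
  ((linearIndependent_expMatrix φ).comp _ Subtype.val_injective).map (disjoint_starSpan_ker hs)

theorem card_starVerts_le (hs : expMatrix φ.toMonoidHom v s ≠ 0) :
    Nat.card (starVerts Γ v) ≤ Nat.card (starVerts Γ' s) := by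
  classical
  cases nonempty_fintype V
  cases nonempty_fintype V'
  have := (linearIndependent_star hs).fintype_card_le_finrank
  simpa [Nat.card_eq_fintype_card] using this

theorem adj_of_card_starVerts_eq (hs : expMatrix φ.toMonoidHom v s ≠ 0)
    (hcard : Nat.card (starVerts Γ v) = Nat.card (starVerts Γ' s))
    {t : V'} (hst : s ≠ t) (hadj : ¬ Γ'.Adj s t) (ht : expMatrix φ.toMonoidHom v t ≠ 0)
    {u : V'} (hu : Γ'.Adj s u) : Γ'.Adj t u := by
  classical
  cases nonempty_fintype V
  cases nonempty_fintype V'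
  -- Equal cardinalities make the restriction onto, so some `y` in the span restricts to the
  -- indicator of `u`. The minor at `s, t` gives `y t = 0`; were `t, u` nonadjacent, their minor
  -- would kill the entry at `t`.
  have hspan := (linearIndependent_star hs).span_eq_top_of_card_eq_finrank' (by
    simpa [Nat.card_eq_fintype_card] using hcard)
  rw [Set.range_comp, ← Submodule.map_span] at hspan
  have hmem : Pi.single (⟨u, Set.mem_insert_of_mem _ hu⟩ : starVerts Γ' s) (1 : ℚ) ∈
      Submodule.map (LinearMap.funLeft ℚ ℚ (Subtype.val : starVerts Γ' s → V')) (starSpan φ v) := by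
    rw [starSpan, hspan]; trivial
  obtain ⟨y, hy, hyu⟩ := hmem
  have h1 : y u = 1 := by
    simpa [LinearMap.funLeft] using congrFun hyu ⟨u, Set.mem_insert_of_mem _ hu⟩
  have h2 : y s = 0 := by
    have := congrFun hyu ⟨s, Set.mem_insert _ _⟩
    rw [Pi.single_eq_of_ne (fun h => hu.ne (congrArg Subtype.val h))] at this
    exact this
  have h3 : y t = 0 := by
    have := mul_eq_of_mem_starSpan hy hst hadj
    rw [h2, zero_mul] at this
    exact (mul_eq_zero.mp this).resolve_left hs
  by_contra htu
  have htu' : t ≠ u := by rintro rfl; exact hadj hu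
  have := mul_eq_of_mem_starSpan hy htu' htu
  rw [h1, h3, zero_mul, mul_one] at this
  exact ht this

end Star

/-- Without separating stars and covers by two stars, no link is contained in the link of a
nonadjacent vertex. -/
theorem exists_adj_not_adj (hsep : ∀ v : V, ¬ IsSeparatingStar Γ v)
    (htwo : ¬ IsUnionOfTwoStars Γ) {s t : V} (hst : s ≠ t) (hadj : ¬ Γ.Adj s t) :
    ∃ u, Γ.Adj s u ∧ ¬ Γ.Adj t u := by
  by_contra! hno
  have hmem : ∀ {a}, a ∉ starVerts Γ t ↔ a ≠ t ∧ ¬ Γ.Adj t a := fun {a} => by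
    rw [starVerts, Set.mem_insert_iff, SimpleGraph.mem_neighborSet, not_or]
  have hs : s ∉ starVerts Γ t := hmem.mpr ⟨hst, fun h => hadj h.symm⟩
  have hpre := not_not.mp (hsep t)
  have honly : ∀ a, a ∉ starVerts Γ t → a = s := by
    intro a ha
    -- All neighbours of `s` lie in the star of `t`, so `s` is isolated in its complement.
    by_contra has
    obtain ⟨p⟩ := hpre ⟨s, hs⟩ ⟨a, ha⟩
    cases p with
    | nil => exact has rfl
    | @cons _ b _ hb _ => exact (hmem.mp b.2).2 (hno b.1 hb)
  refine htwo ⟨t, s, fun F hF => ?_⟩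
  by_cases hsF : s ∈ F
  · refine Or.inr ⟨hF, fun a ha => ?_⟩
    by_cases has : a = s
    · exact has ▸ Set.mem_insert _ _
    · exact Set.mem_insert_of_mem _ (hF.2 hsF ha (Ne.symm has))
  · refine Or.inl ⟨hF, fun a ha => ?_⟩
    by_contra hat
    exact hsF (honly a hat ▸ ha)

theorem nonempty_iso_of_mulEquiv [Finite V] [Finite V']
    (hsep' : ∀ v : V', ¬ IsSeparatingStar Γ' v) (htwo' : ¬ IsUnionOfTwoStars Γ')
    (φ : Grp Γ ≃* Grp Γ') : Nonempty (Γ ≃g Γ') := by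
  classical
  cases nonempty_fintype V
  cases nonempty_fintype V'
  obtain ⟨σ, hσ⟩ := exists_equiv_of_mul_eq_one (expMatrix_mul_symm φ) (expMatrix_mul_symm φ.symm)
  obtain ⟨τ, hτ⟩ := exists_equiv_of_mul_eq_one (expMatrix_mul_symm φ.symm) (expMatrix_mul_symm φ)
  have hle : ∀ v, Nat.card (starVerts Γ v) ≤ Nat.card (starVerts Γ' (σ v)) := fun v =>
    card_starVerts_le (hσ v)
  have hsum : ∑ v, Nat.card (starVerts Γ' (σ v)) ≤ ∑ v, Nat.card (starVerts Γ v) := by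
    rw [σ.sum_comp (fun w => Nat.card (starVerts Γ' w)),
      ← τ.sum_comp (fun v => Nat.card (starVerts Γ v))]
    exact Finset.sum_le_sum fun w _ => card_starVerts_le (hτ w)
  have heq : ∀ v, Nat.card (starVerts Γ v) = Nat.card (starVerts Γ' (σ v)) := fun v =>
    (Finset.sum_eq_sum_iff_of_le fun v _ => hle v).mp
      (le_antisymm (Finset.sum_le_sum fun v _ => hle v) hsum) v (Finset.mem_univ _)
  have hadj : ∀ v w, Γ.Adj v w → Γ'.Adj (σ v) (σ w) := by
    intro v w hvw
    by_contra hn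
    have hne : σ v ≠ σ w := fun h => hvw.ne (σ.injective h)
    -- The minor of rows `v, w` at columns `σ v, σ w` has nonzero diagonal product, so the entry at
    -- `v, σ w` is nonzero too.
    have hmul := mul_eq_of_mem_starSpan (φ := φ) (v := v) (Submodule.subset_span
      ⟨⟨w, Set.mem_insert_of_mem _ hvw⟩, rfl⟩) hne hn
    have ht : expMatrix φ.toMonoidHom v (σ w) ≠ 0 := by
      intro h0
      rw [h0, mul_zero] at hmul
      exact mul_ne_zero (hσ v) (hσ w) hmul
    obtain ⟨u, hu, htu⟩ := exists_adj_not_adj hsep' htwo' hne hn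
    exact htu (adj_of_card_starVerts_eq (hσ v) (heq v) hne hn ht hu)
  have hmaps : ∀ v, ∀ u : starVerts Γ v, σ u ∈ starVerts Γ' (σ v) := by
    rintro v ⟨u, rfl | hu⟩
    · exact Set.mem_insert _ _
    · exact Set.mem_insert_of_mem _ (hadj _ _ hu)
  refine ⟨⟨σ, fun {v w} => ⟨fun h => ?_, hadj v w⟩⟩⟩
  -- Equal star sizes make `σ` bijective between stars, so it also reflects adjacency.
  have hbij : Function.Bijective (fun u : starVerts Γ v =>
      (⟨σ u, hmaps v u⟩ : starVerts Γ' (σ v))) :=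
    (Nat.bijective_iff_injective_and_card _).mpr
      ⟨fun a b hab => Subtype.ext (σ.injective (congrArg Subtype.val hab)), heq v⟩
  obtain ⟨⟨u, hu⟩, he⟩ := hbij.2 ⟨σ w, Set.mem_insert_of_mem _ h⟩
  obtain rfl : u = w := σ.injective (congrArg Subtype.val he)
  rcases hu with rfl | hu
  · exact absurd h (SimpleGraph.irrefl _)
  · exact hu

end Rigidity

end RAAG

theorem corollary4p13 {V₁ : Type*} {V₂ : Type*} [Finite V₁] [Finite V₂]
    (Γ₁ : SimpleGraph V₁) (Γ₂ : SimpleGraph V₂)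
    (hsep₁ : ∀ v : V₁, ¬ RAAG.IsSeparatingStar Γ₁ v)
    (hsep₂ : ∀ v : V₂, ¬ RAAG.IsSeparatingStar Γ₂ v)
    (htwo₁ : ¬ RAAG.IsUnionOfTwoStars Γ₁)
    (htwo₂ : ¬ RAAG.IsUnionOfTwoStars Γ₂) :
    Nonempty (RAAG.Grp Γ₁ ≃* RAAG.Grp Γ₂) ↔
      RAAG.SimpliciallyIsomorphic (RAAG.extensionComplex Γ₁) (RAAG.extensionComplex Γ₂) := by
  constructor
  · rintro ⟨φ⟩
    obtain ⟨f⟩ := RAAG.nonempty_iso_of_mulEquiv hsep₂ htwo₂ φ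
    exact RAAG.simpliciallyIsomorphic_of_iso f
  · intro h
    obtain ⟨e, he⟩ := h.exists_commute_iff
    obtain ⟨f⟩ := RAAG.nonempty_iso_of_extVert_equiv hsep₁ htwo₁ hsep₂ htwo₂ e he
    exact ⟨RAAG.grpCongr f⟩
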